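/- Let $V$ be a finite ground set with a fixed total order, let $\mathcal I\subseteq 2^V$ be a nonempty hereditary family (every subset of a member of $\mathcal I$ is in $\mathcal I$), and let $f:2^V\to\mathbb R_{\ge 0}$ be a (not necessarily monotone) submodular function, i.e. $f(A)+f(B)\ge f(A\cup B)+f(A\cap B)$ for all $A,B\subseteq V$. For $A\subseteq V$, let $\mathrm{Greedy}(A)$ be the output of the following algorithm. Start with $S=\emptyset$. Repeatedly let $C=\{e\in A\setminus S: S\cup\{e\}\in\mathcal I\}$ and let $e\in C$ maximize $f(S\cup\{e\})-f(S)$, with ties broken by the fixed order of $V$. If $C=\emptyset$ or $f(S\cup\{e\})-f(S)<0$, return $S$; otherwise add $e$ to $S$. For $A\subseteq V$, let $\mathrm{DoubleGreedy}(A)$ be the output of the following randomized algorithm. Start with $X=\emptyset$, $Y=A$ and process the elements $u$ of $A$ in the fixed order. Put $a=\max\{f(X\cup\{u\})-f(X),0\}$ and $b=\max\{f(Y\setminus\{u\})-f(Y),0\}$. With probability $a/(a+b)$ (read as $1$ if $a=b=0$) replace $X$ by $X\cup\{u\}$, and otherwise replace $Y$ by $Y\setminus\{u\}$; the coin is fresh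 for each element. At the end return $X$ (which then equals $Y$). Let $\mathrm{Alg}(A)$ return a set of largest $f$-value among $T_1=\mathrm{Greedy}(A)$, $T_2=\mathrm{Greedy}(A\setminus T_1)$ and $T_3=\mathrm{DoubleGreedy}(T_1)$. Given $V'\subseteq V$ and a number $m\ge 1$ of machines, $\mathrm{NMRandGreeDi}(V')$ assigns each element of $V'$ to one of the $m$ machines independently and uniformly at random. With $V_i$ the set of elements of machine $i$, it computes $S_i^1=\mathrm{Greedy}(V_i)$ and $S_i^2=\mathrm{Greedy}(V_i\setminus S_i^1)$ for every $i$, then computes $T=\mathrm{Alg}\big(\bigcup_i(S_i^1\cup S_i^2)\big)$ with fresh randomness, and returns a set $D$ of largest $f$-value among $T$ and all the $S_i^1,S_i^2$. Let $\alpha\ge 0$ and suppose that $\mathrm{Greedy}$ satisfies the following property (GP) on every restricted instance: for all $A\subseteq V$ and all $S\subseteq A$ with $S\in\mathcal I$, $$f(\mathrm{Greedy}(A))\ \ge\ \alpha\cdot f(\mathrm{Greedy}(A)\cup S).$$ Then for every $m\ge1$, $\mathrm{NMRandGreeDi}$ achieves in expectation an $\frac{\alpha}{4+2\alpha}$-approximation: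 for every $V'\subseteq V$, the output $D$ of $\mathrm{NMRandGreeDi}(V')$ always satisfies $D\subseteq V'$ and $D\in\mathcal I$, and for every $O\subseteq V'$ with $O\in\mathcal I$, $$\mathbb E[f(D)]\ \ge\ \frac{\alpha}{4+2\alpha}\, f(O).$$ -/

import Mathlib

open scoped NNReal

/-- `f(A) + f(B) ≥ f(A ∪ B) + f(A ∩ B)` for all sets `A`, `B`. -/
def IsSubmodular {V : Type*} [DecidableEq V] (f : Finset V → ℝ) : Prop :=
  ∀ A B : Finset V, f (A ∪ B) + f (A ∩ B) ≤ f A + f B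

noncomputable section

open Classical in
/-- The elements of `A` that the greedy algorithm may add to the current solution `S`. -/
def greedyCandidates {V : Type*} [LinearOrder V] (I : Set (Finset V)) (A S : Finset V) :
    Finset V :=
  A.filter (fun e => e ∉ S ∧ insert e S ∈ I)

open Classical in
/-- The candidates whose marginal gain is largest. -/
def greedyBest {V : Type*} [LinearOrder V] (I : Set (Finset V)) (f : Finset V → ℝ)
    (A S : Finset V) : Finset V :=
  (greedyCandidates I A S).filter
    (fun e => ∀ e' ∈ greedyCandidates I A S, f (insert e' S) - f S ≤ f (insert e S) - f S)

theorem mem_greedyCandidates {V : Type*} [LinearOrder V] (I : Set (Finset V))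
    (A S : Finset V) (e : V) :
    e ∈ greedyCandidates I A S ↔ e ∈ A ∧ e ∉ S ∧ insert e S ∈ I := by
  simp [greedyCandidates]

theorem mem_greedyBest {V : Type*} [LinearOrder V] (I : Set (Finset V)) (f : Finset V → ℝ)
    (A S : Finset V) (e : V) :
    e ∈ greedyBest I f A S ↔ e ∈ greedyCandidates I A S ∧
      ∀ e' ∈ greedyCandidates I A S, f (insert e' S) - f S ≤ f (insert e S) - f S := by
  simp [greedyBest]

/-- One pass through the loop of the greedy algorithm on the ground set `A`. A candidate of
largest marginal gain is added, unless there is no candidate or this gain is negative. Ties are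
broken by the linear order of `V`. When the algorithm has to stop, the solution is unchanged. -/
def greedyStep {V : Type*} [LinearOrder V] (I : Set (Finset V)) (f : Finset V → ℝ)
    (A S : Finset V) : Finset V :=
  if h : (greedyBest I f A S).Nonempty then
    if f (insert ((greedyBest I f A S).min' h) S) - f S < 0 then S
    else insert ((greedyBest I f A S).min' h) S
  else S

/-- The standard greedy algorithm on the ground set `A`, started at the empty set. A pass that
does not stop adds a new element, so that after `|V|` passes the algorithm has stopped
(`greedyStep_greedy`). -/
def greedy {V : Type*} [Fintype V] [LinearOrder V] (I : Set (Finset V)) (f : Finset V → ℝ)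
    (A : Finset V) : Finset V :=
  (greedyStep I f A)^[Fintype.card V] ∅

/-- The greedy algorithm has indeed stopped at its output. -/
theorem greedyStep_greedy {V : Type*} [Fintype V] [LinearOrder V] (I : Set (Finset V))
    (f : Finset V → ℝ) (A : Finset V) :
    greedyStep I f A (greedy I f A) = greedy I f A := by
  have key : ∀ S : Finset V, greedyStep I f A S = S ∨ (greedyStep I f A S).card = S.card + 1 := by
    intro S
    unfold greedyStep
    split_ifs with h h'
    · exact Or.inl rfl
    · right
      have hm : (greedyBest I f A S).min' h ∈ greedyCandidates I A S :=
        ((mem_greedyBest I f A S _).1 (Finset.min'_mem _ h)).1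
      exact Finset.card_insert_of_notMem ((mem_greedyCandidates I A S _).1 hm).2.1
    · exact Or.inl rfl
  have iter : ∀ n : ℕ,
      greedyStep I f A ((greedyStep I f A)^[n] ∅) = (greedyStep I f A)^[n] ∅ ∨
        ((greedyStep I f A)^[n] ∅).card = n := by
    intro n
    induction n with
    | zero => right; simp
    | succ n ih =>
      rw [Function.iterate_succ_apply']
      rcases ih with ih | ih
      · left; rw [ih, ih]
      · rcases key ((greedyStep I f A)^[n] ∅) with h | h
        · left; rw [h, h]
        · right; omega
  unfold greedy
  rcases iter (Fintype.card V) with h | h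
  · exact h
  · rcases key ((greedyStep I f A)^[Fintype.card V] ∅) with h2 | h2
    · exact h2
    · have := Finset.card_le_univ (greedyStep I f A ((greedyStep I f A)^[Fintype.card V] ∅))
      omega

/-- The greedy property with constant `α`, for the restricted instance on every ground set
`A ⊆ V`: the output of the greedy algorithm on `A` satisfies
`f(Greedy(A)) ≥ α f(Greedy(A) ∪ S)` for every feasible `S ⊆ A`. -/
def GreedyProperty {V : Type*} [Fintype V] [LinearOrder V] (I : Set (Finset V))
    (f : Finset V → ℝ) (α : ℝ) : Prop :=
  ∀ A S : Finset V, S ⊆ A → S ∈ I → α * f (greedy I f A ∪ S) ≤ f (greedy I f A)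

/-- The best solution (with respect to `f`) amongst `A` and the members of a list. -/
def bestOf {V : Type*} (f : Finset V → ℝ) (A : Finset V) (L : List (Finset V)) : Finset V :=
  L.foldl (fun B C => if f B < f C then C else B) A

/-- `a⁺ / (a⁺ + b⁺)`, which is read as `1` if `a⁺ = b⁺ = 0`. -/
def doubleGreedyProb (a b : ℝ) : ℝ≥0 :=
  if a.toNNReal + b.toNNReal = 0 then 1 else a.toNNReal / (a.toNNReal + b.toNNReal)

theorem doubleGreedyProb_le_one (a b : ℝ) : doubleGreedyProb a b ≤ 1 := by
  unfold doubleGreedyProb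
  split_ifs with h
  · exact le_rfl
  · exact div_le_one_of_le₀ le_self_add (by positivity)

/-- The loop of the randomized Double Greedy algorithm, processing the elements of a list in
order. The element `u` is added to `X` with probability `a⁺ / (a⁺ + b⁺)`, where
`a = f(X ∪ {u}) - f(X)` and `b = f(Y \ {u}) - f(Y)`, and otherwise it is removed from `Y`. -/
def doubleGreedyLoop {V : Type*} [DecidableEq V] (f : Finset V → ℝ) :
    List V → Finset V → Finset V → PMF (Finset V)
  | [], X, _ => PMF.pure X
  | u :: l, X, Y =>
    (PMF.bernoulli (doubleGreedyProb (f (insert u X) - f X) (f (Y.erase u) - f Y))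
      (doubleGreedyProb_le_one _ _)).bind
      (fun c => if c then doubleGreedyLoop f l (insert u X) Y
        else doubleGreedyLoop f l X (Y.erase u))

/-- The randomized Double Greedy algorithm for unconstrained maximization of `f` over the subsets
of `A`: it starts with `X = ∅` and `Y = A`, and goes through the elements of `A` in increasing
order. -/
def doubleGreedy {V : Type*} [LinearOrder V] (f : Finset V → ℝ) (A : Finset V) :
    PMF (Finset V) :=
  doubleGreedyLoop f (A.sort (· ≤ ·)) ∅ A

/-- The algorithm of the last machine: `T₁ = Greedy(A)`, `T₂ = Greedy(A \ T₁)`, `T₃` is the output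
of Double Greedy on `T₁`, and the best of `T₁`, `T₂`, `T₃` is returned. -/
def greedyTwiceDoubleGreedy {V : Type*} [Fintype V] [LinearOrder V] (I : Set (Finset V))
    (f : Finset V → ℝ) (A : Finset V) : PMF (Finset V) :=
  (doubleGreedy f (greedy I f A)).map
    (fun T₃ => bestOf f (greedy I f A) [greedy I f (A \ greedy I f A), T₃])

/-- The elements of the ground set `A` that the assignment `σ` sends to machine `i`. -/
def machinePart {V : Type*} {m : ℕ} (A : Finset V) (σ : V → Fin m) (i : Fin m) : Finset V :=
  A.filter (fun e => σ e = i)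

/-- The first greedy solution `S¹ᵢ = Greedy(Vᵢ)` of machine `i`. -/
def firstSol {V : Type*} [Fintype V] [LinearOrder V] {m : ℕ} (I : Set (Finset V))
    (f : Finset V → ℝ) (A : Finset V) (σ : V → Fin m) (i : Fin m) : Finset V :=
  greedy I f (machinePart A σ i)

/-- The second greedy solution `S²ᵢ = Greedy(Vᵢ \ S¹ᵢ)` of machine `i`. -/
def secondSol {V : Type*} [Fintype V] [LinearOrder V] {m : ℕ} (I : Set (Finset V))
    (f : Finset V → ℝ) (A : Finset V) (σ : V → Fin m) (i : Fin m) : Finset V :=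
  greedy I f (machinePart A σ i \ firstSol I f A σ i)

/-- The distributed algorithm on the ground set `A` with `m` machines and with the (randomized)
algorithm `alg` on the last machine. A uniformly random map `σ : V → Fin m` assigns every element
to a machine uniformly at random, independently of the others. -/
def nmRandGreeDi {V : Type*} [Fintype V] [LinearOrder V] (I : Set (Finset V))
    (f : Finset V → ℝ) (m : ℕ) [NeZero m] (alg : Finset V → PMF (Finset V)) (A : Finset V) :
    PMF (Finset V) :=
  (PMF.uniformOfFintype (V → Fin m)).bind (fun σ =>
    (alg (Finset.univ.biUnion (fun i => firstSol I f A σ i ∪ secondSol I f A σ i))).map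
      (fun T => bestOf f T
        ((List.finRange m).flatMap (fun i => [firstSol I f A σ i, secondSol I f A σ i]))))

/-- The expectation of `f(D)` for a random set `D` with law `p`. -/
def expectedValue {V : Type*} [Fintype V] (p : PMF (Finset V)) (f : Finset V → ℝ) : ℝ :=
  ∑ D : Finset V, (p D).toReal * f D

/-- The randomized algorithm `alg` is, in expectation, a `ρ`-approximation for maximizing `f`
subject to `I`: on every ground set `A ⊆ V` it always returns a feasible subset of `A`, and its
expected value is at least `ρ f(O)` for every feasible `O ⊆ A`. -/
def IsApproxInExpectation {V : Type*} [Fintype V] (I : Set (Finset V)) (f : Finset V → ℝ)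
    (alg : Finset V → PMF (Finset V)) (ρ : ℝ) : Prop :=
  ∀ A : Finset V, (∀ D ∈ (alg A).support, D ⊆ A ∧ D ∈ I) ∧
    ∀ O : Finset V, O ⊆ A → O ∈ I → ρ * f O ≤ expectedValue (alg A) f

end

/-! For each machine, call an element of `O` lost if two-pass greedy would reject it when it is
added to that machine's part. Elements rejected one at a time can be added all at once without
changing greedy (`greedy_union_eq`), so (GP) applies to both passes. Their outputs are disjoint, and
submodularity with nonnegativity then replaces monotonicity: `α f(lost)` is at most the sum of the
two solution values, hence at most twice the final value (`mul_le_greedy_add_greedy`).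

The elements of `O` that reach the last machine form a feasible set there, worth at most `(2 +
2α)/α` times the expected final value when `α > 0` (`mul_le_expectedValue_greedyTwiceDoubleGreedy`).

Under a random assignment, an element is selected with the same probability with which a random
machine would select it if it were added there. So the frequencies of being lost and of being
selected add up to one. A modular minorant of `f`, tight at `O`, turns this count into the statement
that the values of the two sets average to at least `f O` in total (`card_mul_le_sum_machinePart`).
Adding the bounds gives `2 + (2 + 2α) = 4 + 2α`. -/

theorem IsSubmodular.marginal_antitone {V : Type*} [DecidableEq V] {f : Finset V → ℝ}
    (hf : IsSubmodular f) {A B : Finset V} {u : V} (hAB : A ⊆ B) (hu : u ∉ B) :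
    f (insert u B) - f B ≤ f (insert u A) - f A := by
  have h := hf (insert u A) B
  have h1 : insert u A ∪ B = insert u B := by
    rw [Finset.insert_union, Finset.union_eq_right.2 hAB]
  have h2 : insert u A ∩ B = A := by
    rw [Finset.insert_inter_of_notMem hu, Finset.inter_eq_left.2 hAB]
  rw [h1, h2] at h
  linarith

/-- A submodular function is bounded below on the subsets of `O` by an affine function which
agrees with it at `O`. -/
theorem IsSubmodular.exists_modular_minorant {V : Type*} [DecidableEq V] {f : Finset V → ℝ}
    (hf : IsSubmodular f) (O : Finset V) :
    ∃ g : V → ℝ, f ∅ + ∑ e ∈ O, g e = f O ∧ ∀ A ⊆ O, f ∅ + ∑ e ∈ A, g e ≤ f A := by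
  induction O using Finset.induction_on with
  | empty =>
    refine ⟨0, by simp, fun A hA => ?_⟩
    simp [Finset.subset_empty.1 hA]
  | insert u O hu ih =>
    obtain ⟨g, hgO, hg⟩ := ih
    have hsum : ∀ A : Finset V, u ∉ A →
        ∑ e ∈ A, Function.update g u (f (insert u O) - f O) e = ∑ e ∈ A, g e := fun A hA =>
      Finset.sum_congr rfl fun e he =>
        Function.update_of_ne (fun h : e = u => hA (h ▸ he)) _ _
    -- The weight of an element is its marginal gain over those inserted before it; over a smaller
    -- set the gain can only be larger.
    refine ⟨Function.update g u (f (insert u O) - f O), ?_, fun A hA => ?_⟩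
    · rw [Finset.sum_insert hu, hsum O hu, Function.update_self]
      linarith
    · by_cases huA : u ∈ A
      · have hE : A.erase u ⊆ O := Finset.subset_insert_iff.1 hA
        have h1 := hg _ hE
        have h2 := hf.marginal_antitone hE hu
        rw [Finset.insert_erase huA] at h2
        rw [← Finset.add_sum_erase A _ huA, hsum _ (Finset.notMem_erase u A),
          Function.update_self]
        linarith
      · rw [hsum A huA]
        exact hg A ((Finset.subset_insert_iff_of_notMem huA).1 hA)

/-- The two unions meet exactly in `O`, and the value of their union is dropped by nonnegativity.
This stands in for monotonicity of `f`. -/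
theorem IsSubmodular.le_add_of_union_of_disjoint {V : Type*} [DecidableEq V]
    {f : Finset V → ℝ} (hf0 : ∀ A, 0 ≤ f A) (hf : IsSubmodular f) {S T : Finset V}
    (hST : Disjoint S T) (O : Finset V) : f O ≤ f (S ∪ O) + f (T ∪ O) := by
  have h := hf (S ∪ O) (T ∪ O)
  have hi : (S ∪ O) ∩ (T ∪ O) = O := by
    rw [← Finset.inter_union_distrib_right, Finset.disjoint_iff_inter_eq_empty.1 hST,
      Finset.empty_union]
  rw [hi] at h
  linarith [hf0 (S ∪ O ∪ (T ∪ O))]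

/-! ### Expected values of random sets -/

section Expectation

variable {V : Type*} [Fintype V]

theorem expectedValue_pure (S : Finset V) (f : Finset V → ℝ) :
    expectedValue (PMF.pure S) f = f S := by
  classical
  unfold expectedValue
  rw [Finset.sum_eq_single S] <;> simp +contextual [PMF.pure_apply]

theorem expectedValue_bind {β : Type*} [Fintype β] (p : PMF β) (q : β → PMF (Finset V))
    (f : Finset V → ℝ) :
    expectedValue (p.bind q) f = ∑ b, (p b).toReal * expectedValue (q b) f := by
  unfold expectedValue
  simp_rw [Finset.mul_sum]
  rw [Finset.sum_comm]
  refine Finset.sum_congr rfl fun D _ => ?_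
  rw [PMF.bind_apply, tsum_fintype, ENNReal.toReal_sum fun b _ =>
    ENNReal.mul_ne_top (p.apply_ne_top b) ((q b).apply_ne_top D), Finset.sum_mul]
  simp only [ENNReal.toReal_mul, mul_assoc]

theorem expectedValue_map (p : PMF (Finset V)) (g : Finset V → Finset V) (f : Finset V → ℝ) :
    expectedValue (p.map g) f = expectedValue p (fun D => f (g D)) := by
  rw [← PMF.bind_pure_comp, expectedValue_bind]
  simp only [Function.comp_apply, expectedValue_pure]
  rfl

theorem expectedValue_mono (p : PMF (Finset V)) {f g : Finset V → ℝ} (h : ∀ D, f D ≤ g D) :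
    expectedValue p f ≤ expectedValue p g :=
  Finset.sum_le_sum fun D _ => mul_le_mul_of_nonneg_left (h D) ENNReal.toReal_nonneg

theorem expectedValue_const (p : PMF (Finset V)) (c : ℝ) :
    expectedValue p (fun _ => c) = c := by
  unfold expectedValue
  rw [← Finset.sum_mul, ← ENNReal.toReal_sum fun D _ => p.apply_ne_top D, ← tsum_fintype (L := .unconditional _),
    p.tsum_coe, ENNReal.toReal_one, one_mul]

end Expectation

/-! ### Choosing the best of finitely many solutions -/

section BestOf

variable {V : Type*} (f : Finset V → ℝ)

theorem bestOf_cons (A B : Finset V) (L : List (Finset V)) :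
    bestOf f A (B :: L) = bestOf f (if f A < f B then B else A) L := rfl

theorem bestOf_mem (A : Finset V) (L : List (Finset V)) : bestOf f A L ∈ A :: L := by
  induction L generalizing A with
  | nil => simp [bestOf]
  | cons B L ih =>
    rw [bestOf_cons]
    have := ih (if f A < f B then B else A)
    split_ifs at this ⊢ <;> simp only [List.mem_cons] at this ⊢ <;> tauto

theorem le_bestOf {A C : Finset V} {L : List (Finset V)} (hC : C ∈ A :: L) :
    f C ≤ f (bestOf f A L) := by
  induction L generalizing A C with
  | nil =>
    rw [List.mem_singleton.1 hC]
    rfl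
  | cons B L ih =>
    rw [bestOf_cons]
    have hhead := ih (A := if f A < f B then B else A) List.mem_cons_self
    rcases List.mem_cons.1 hC with rfl | hC
    · refine le_trans ?_ hhead
      split_ifs with h
      · exact h.le
      · exact le_rfl
    rcases List.mem_cons.1 hC with rfl | hC
    · refine le_trans ?_ hhead
      split_ifs with h
      · exact le_rfl
      · exact not_lt.1 h
    · exact ih (List.mem_cons_of_mem _ hC)

end BestOf

/-! ### Consistency of greedy under rejected elements -/

section Greedy

variable {V : Type*} [LinearOrder V] {I : Set (Finset V)} {f : Finset V → ℝ}

theorem greedyStep_eq_or (I : Set (Finset V)) (f : Finset V → ℝ) (A S : Finset V) :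
    greedyStep I f A S = S ∨
      ∃ e ∈ greedyCandidates I A S, greedyStep I f A S = insert e S := by
  unfold greedyStep
  split_ifs with h h'
  · exact Or.inl rfl
  · exact Or.inr ⟨_, ((mem_greedyBest I f A S _).1 (Finset.min'_mem _ h)).1, rfl⟩
  · exact Or.inl rfl

theorem subset_greedyStep (A S : Finset V) : S ⊆ greedyStep I f A S := by
  rcases greedyStep_eq_or I f A S with h | ⟨e, -, h⟩ <;> rw [h]
  exact Finset.subset_insert e S

theorem greedyStep_subset {A S : Finset V} (h : S ⊆ A) : greedyStep I f A S ⊆ A := by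
  rcases greedyStep_eq_or I f A S with h' | ⟨e, he, h'⟩ <;> rw [h']
  · exact h
  · exact Finset.insert_subset ((mem_greedyCandidates I A S e).1 he).1 h

theorem greedyStep_mem {A S : Finset V} (h : S ∈ I) : greedyStep I f A S ∈ I := by
  rcases greedyStep_eq_or I f A S with h' | ⟨e, he, h'⟩ <;> rw [h']
  · exact h
  · exact ((mem_greedyCandidates I A S e).1 he).2.2

theorem greedyCandidates_mono {A B : Finset V} (hAB : A ⊆ B) (S : Finset V) :
    greedyCandidates I A S ⊆ greedyCandidates I B S := by
  intro e he
  rw [mem_greedyCandidates] at he ⊢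
  exact ⟨hAB he.1, he.2⟩

theorem greedyBest_nonempty {A S : Finset V} (h : (greedyCandidates I A S).Nonempty) :
    (greedyBest I f A S).Nonempty := by
  obtain ⟨e, he, hmax⟩ :=
    Finset.exists_max_image _ (fun e => f (insert e S) - f S) h
  exact ⟨e, (mem_greedyBest I f A S e).2 ⟨he, hmax⟩⟩

/-- Elements that are not chosen by a greedy step do not influence it. -/
theorem greedyStep_eq_of_subset {A B S : Finset V} (hAB : A ⊆ B)
    (h : greedyStep I f B S ⊆ A) : greedyStep I f A S = greedyStep I f B S := by
  by_cases hA : (greedyBest I f A S).Nonempty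
  · have hc : (greedyCandidates I A S).Nonempty :=
      hA.mono fun e he => ((mem_greedyBest I f A S e).1 he).1
    have hB : (greedyBest I f B S).Nonempty :=
      greedyBest_nonempty (hc.mono (greedyCandidates_mono hAB S))
    have hxA := (mem_greedyBest I f A S _).1 (Finset.min'_mem _ hA)
    have hxB := (mem_greedyBest I f B S _).1 (Finset.min'_mem _ hB)
    set x := (greedyBest I f A S).min' hA with hx
    set y := (greedyBest I f B S).min' hB with hy
    have hxy := hxB.2 x (greedyCandidates_mono hAB S hxA.1)
    have hstepA : greedyStep I f A S = if f (insert x S) - f S < 0 then S else insert x S := by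
      rw [greedyStep, dif_pos hA]
    have hstepB : greedyStep I f B S = if f (insert y S) - f S < 0 then S else insert y S := by
      rw [greedyStep, dif_pos hB]
    rw [hstepB] at h ⊢
    rw [hstepA]
    by_cases hneg : f (insert y S) - f S < 0
    · rw [if_pos hneg, if_pos (hxy.trans_lt hneg)]
    · rw [if_neg hneg] at h ⊢
      have hyA : y ∈ greedyCandidates I A S :=
        (mem_greedyCandidates I A S y).2 ⟨h (Finset.mem_insert_self y S),
          ((mem_greedyCandidates I B S y).1 hxB.1).2⟩
      have hyx := hxA.2 y hyA
      have hybest : y ∈ greedyBest I f A S :=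
        (mem_greedyBest I f A S y).2
          ⟨hyA, fun e he => hxB.2 e (greedyCandidates_mono hAB S he)⟩
      have hxbest : x ∈ greedyBest I f B S :=
        (mem_greedyBest I f B S x).2
          ⟨greedyCandidates_mono hAB S hxA.1, fun e he => (hxB.2 e he).trans hyx⟩
      -- Both elements are optimal for both ground sets, so the common tie-breaking order identifies
      -- them.
      have hEq : x = y :=
        le_antisymm (Finset.min'_le _ _ hybest) (Finset.min'_le _ _ hxbest)
      rw [hEq, if_neg hneg]
  · have hSA : greedyStep I f A S = S := by rw [greedyStep, dif_neg hA]
    rcases greedyStep_eq_or I f B S with h' | ⟨e, he, h'⟩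
    · rw [hSA, h']
    · refine absurd (greedyBest_nonempty ⟨e, (mem_greedyCandidates I A S e).2
        ⟨h ?_, ((mem_greedyCandidates I B S e).1 he).2⟩⟩) hA
      rw [h']
      exact Finset.mem_insert_self e S

theorem greedyStep_iterate_subset (A : Finset V) (n : ℕ) :
    (greedyStep I f A)^[n] ∅ ⊆ A := by
  induction n with
  | zero => simp
  | succ n ih =>
    rw [Function.iterate_succ_apply']
    exact greedyStep_subset ih

theorem greedyStep_iterate_mono (A : Finset V) :
    Monotone fun n => (greedyStep I f A)^[n] ∅ :=
  monotone_nat_of_le_succ fun n => by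
    rw [Function.iterate_succ_apply']
    exact subset_greedyStep _ _

theorem greedyStep_iterate_eq_of_subset {A B : Finset V} (hAB : A ⊆ B) {n : ℕ}
    (h : (greedyStep I f B)^[n] ∅ ⊆ A) :
    (greedyStep I f A)^[n] ∅ = (greedyStep I f B)^[n] ∅ := by
  induction n with
  | zero => rfl
  | succ n ih =>
    have hn := ih ((greedyStep_iterate_mono B n.le_succ).trans h)
    rw [Function.iterate_succ_apply'] at h
    rw [Function.iterate_succ_apply', Function.iterate_succ_apply', hn]
    exact greedyStep_eq_of_subset hAB h

variable [Fintype V]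

theorem greedy_subset (A : Finset V) : greedy I f A ⊆ A :=
  greedyStep_iterate_subset A _

theorem greedy_mem (h : ∅ ∈ I) (A : Finset V) : greedy I f A ∈ I := by
  unfold greedy
  induction Fintype.card V with
  | zero => exact h
  | succ n ih =>
    rw [Function.iterate_succ_apply']
    exact greedyStep_mem ih

/-- Adding elements which the greedy algorithm rejects one at a time does not change its
output. -/
theorem greedy_union_eq {A B : Finset V} (hB : ∀ e ∈ B, e ∉ greedy I f (insert e A)) :
    greedy I f (A ∪ B) = greedy I f A := by
  have key : ∀ n ≤ Fintype.card V, (greedyStep I f (A ∪ B))^[n] ∅ ⊆ A := by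
    intro n hn
    induction n with
    | zero => simp
    | succ n ih =>
      have ihn := ih (Nat.le_of_succ_le hn)
      intro x hx
      by_contra hxA
      have hxAB := greedyStep_iterate_subset _ _ hx
      have hxB : x ∈ B := (Finset.mem_union.1 hxAB).resolve_left hxA
      have hsub : insert x A ⊆ A ∪ B := Finset.insert_subset hxAB Finset.subset_union_left
      -- If `x` is the first selected element outside `A`, the run so far lives in `insert x A`, so
      -- greedy on `insert x A` would also select `x`.
      have hstep : (greedyStep I f (A ∪ B))^[n + 1] ∅ ⊆ insert x A := by
        rw [Function.iterate_succ_apply'] at hx ⊢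
        rcases greedyStep_eq_or I f (A ∪ B) ((greedyStep I f (A ∪ B))^[n] ∅) with h | ⟨e, -, h⟩
        · rw [h]
          exact ihn.trans (Finset.subset_insert x A)
        · rw [h] at hx ⊢
          rcases Finset.mem_insert.1 hx with rfl | hx
          · exact Finset.insert_subset_insert _ ihn
          · exact absurd (ihn hx) hxA
      rw [← greedyStep_iterate_eq_of_subset hsub hstep] at hx
      exact hB x hxB (greedyStep_iterate_mono _ hn hx)
  exact (greedyStep_iterate_eq_of_subset Finset.subset_union_left (key _ le_rfl)).symm

/-- The union of the two solutions that the greedy algorithm finds in two passes. -/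
noncomputable def twoPassGreedy (I : Set (Finset V)) (f : Finset V → ℝ) (A : Finset V) : Finset V :=
  greedy I f A ∪ greedy I f (A \ greedy I f A)

theorem twoPassGreedy_subset (A : Finset V) : twoPassGreedy I f A ⊆ A :=
  Finset.union_subset (greedy_subset A) ((greedy_subset _).trans Finset.sdiff_subset)

theorem disjoint_greedy_greedy_sdiff (A : Finset V) :
    Disjoint (greedy I f A) (greedy I f (A \ greedy I f A)) :=
  Finset.disjoint_sdiff.mono_right (greedy_subset _)

/-- The two greedy solutions are jointly competitive with the feasible sets of elements that are
rejected by both passes. -/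
theorem mul_le_greedy_add_greedy (hf0 : ∀ A : Finset V, 0 ≤ f A) (hf : IsSubmodular f)
    {α : ℝ} (hα : 0 ≤ α) (hGP : GreedyProperty I f α) {A O : Finset V} (hO : O ∈ I)
    (hrej : ∀ e ∈ O, e ∉ twoPassGreedy I f (insert e A)) :
    α * f O ≤ f (greedy I f A) + f (greedy I f (A \ greedy I f A)) := by
  have hrej1 : ∀ e ∈ O, e ∉ greedy I f (insert e A) := fun e he h =>
    hrej e he (Finset.mem_union_left _ h)
  have hsingle : ∀ e ∈ O, greedy I f (insert e A) = greedy I f A := by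
    intro e he
    have := greedy_union_eq (I := I) (f := f) (A := A) (B := {e}) fun x hx => by
      rw [Finset.mem_singleton.1 hx]
      exact hrej1 e he
    rwa [Finset.union_comm, ← Finset.insert_eq] at this
  -- Since `e` does not alter the first pass, it is still available to the second one, which must
  -- reject it too.
  have hrej2 : ∀ e ∈ O, e ∉ greedy I f (insert e (A \ greedy I f A)) := by
    intro e he h
    have h1 := hrej1 e he
    rw [hsingle e he] at h1
    refine hrej e he (Finset.mem_union_right _ ?_)
    rwa [hsingle e he, Finset.insert_sdiff_of_notMem _ h1]
  -- `O` need not lie in `A`, so (GP) is used on the enlarged ground sets, where the outputs are the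
  -- same.
  have h1 := hGP (A ∪ O) O Finset.subset_union_right hO
  have h2 := hGP (A \ greedy I f A ∪ O) O Finset.subset_union_right hO
  rw [greedy_union_eq hrej1] at h1
  rw [greedy_union_eq hrej2] at h2
  have h3 := mul_le_mul_of_nonneg_left
    (hf.le_add_of_union_of_disjoint hf0 (disjoint_greedy_greedy_sdiff (I := I) (f := f) A) O) hα
  linarith

end Greedy

/-! ### Randomized double greedy is a 1/2-approximation -/

section DoubleGreedy

/-- The expected drift of the double greedy potential is bounded below by the first expression if
the element is in `O` and by the second if not. For positive `a`, `b` both equal `(a - b)² / (a +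
b)`. -/
theorem doubleGreedyProb_spec {a b : ℝ} (hab : 0 ≤ a + b) :
    0 ≤ (doubleGreedyProb a b : ℝ) * a + (1 - (doubleGreedyProb a b : ℝ)) * (b - 2 * a) ∧
      0 ≤ (doubleGreedyProb a b : ℝ) * (a - 2 * b) + (1 - (doubleGreedyProb a b : ℝ)) * b := by
  unfold doubleGreedyProb
  split_ifs with h
  -- Here `a` and `b` are nonpositive with nonnegative sum, so both vanish.
  · obtain ⟨ha, hb⟩ := add_eq_zero.1 h
    rw [Real.toNNReal_eq_zero] at ha hb
    constructor <;> norm_num <;> linarith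
  · have hs : (0 : ℝ) < max a 0 + max b 0 := by
      have := NNReal.coe_pos.2 (pos_iff_ne_zero.2 h)
      rwa [NNReal.coe_add, Real.coe_toNNReal', Real.coe_toNNReal'] at this
    have hq : 1 - max a 0 / (max a 0 + max b 0) = max b 0 / (max a 0 + max b 0) := by
      rw [eq_div_iff hs.ne', sub_mul, div_mul_cancel₀ _ hs.ne']
      ring
    rw [NNReal.coe_div, NNReal.coe_add, Real.coe_toNNReal', Real.coe_toNNReal', hq,
      div_mul_eq_mul_div, div_mul_eq_mul_div, div_mul_eq_mul_div, div_mul_eq_mul_div,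
      ← add_div, ← add_div]
    refine ⟨div_nonneg ?_ hs.le, div_nonneg ?_ hs.le⟩ <;>
    · rcases max_cases a 0 with ⟨h1, h1'⟩ | ⟨h1, h1'⟩ <;>
      rcases max_cases b 0 with ⟨h2, h2'⟩ | ⟨h2, h2'⟩ <;> rw [h1, h2] <;>
      nlinarith [sq_nonneg (a - b)]

theorem subset_of_mem_support_doubleGreedyLoop {V : Type*} [DecidableEq V]
    (f : Finset V → ℝ) {l : List V} {X Y D : Finset V}
    (hD : D ∈ (doubleGreedyLoop f l X Y).support) : D ⊆ X ∪ l.toFinset := by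
  induction l generalizing X Y with
  | nil =>
    rw [doubleGreedyLoop, PMF.support_pure, Set.mem_singleton_iff] at hD
    simp [hD]
  | cons u l ih =>
    rw [doubleGreedyLoop, PMF.mem_support_bind_iff] at hD
    obtain ⟨c, -, hc⟩ := hD
    rw [List.toFinset_cons, Finset.union_insert]
    cases c with
    | true => simpa only [Finset.insert_union] using ih hc
    | false => exact (ih hc).trans (Finset.subset_insert _ _)

-- The potential `2 f((O ∪ X) ∩ Y) + f X + f Y` does not decrease in expectation, and equals `4 f X`
-- once `X = Y`. The set `(O ∪ X) ∩ Y` is `O` corrected by the decisions made so far.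
set_option linter.deprecated false in
theorem le_expectedValue_doubleGreedyLoop {V : Type*} [Fintype V] [DecidableEq V]
    {f : Finset V → ℝ} (hf : IsSubmodular f) (O : Finset V) {l : List V} (hl : l.Nodup)
    {X Y : Finset V} (hX : ∀ u ∈ l, u ∉ X) (hY : Y = X ∪ l.toFinset) :
    2 * f ((O ∪ X) ∩ Y) + f X + f Y ≤ 4 * expectedValue (doubleGreedyLoop f l X Y) f := by
  induction l generalizing X Y with
  | nil =>
    have hYX : Y = X := by simpa using hY
    rw [doubleGreedyLoop, expectedValue_pure, hYX,
      Finset.inter_eq_right.2 Finset.subset_union_right]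
    linarith
  | cons u l ih =>
    have huX : u ∉ X := hX u List.mem_cons_self
    obtain ⟨hul, hl⟩ := List.nodup_cons.1 hl
    have huY : u ∈ Y := by simp [hY]
    have hXY : X ⊆ Y.erase u := fun x hx =>
      Finset.mem_erase.2 ⟨fun h => huX (h ▸ hx), by simp [hY, hx]⟩
    have h1 := ih hl (X := insert u X) (Y := Y)
      (fun v hv h => by
        rcases Finset.mem_insert.1 h with rfl | h
        · exact hul hv
        · exact hX v (List.mem_cons_of_mem _ hv) h)
      (by rw [hY, List.toFinset_cons, Finset.union_insert, Finset.insert_union])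
    have h2 := ih hl (X := X) (Y := Y.erase u) (fun v hv => hX v (List.mem_cons_of_mem _ hv))
      (by
        rw [hY, List.toFinset_cons, Finset.union_insert, Finset.erase_insert]
        simp [huX, hul])
    have hab : 0 ≤ (f (insert u X) - f X) + (f (Y.erase u) - f Y) := by
      have := hf.marginal_antitone hXY (Finset.notMem_erase u Y)
      rw [Finset.insert_erase huY] at this
      linarith
    have hstep : expectedValue (doubleGreedyLoop f (u :: l) X Y) f =
        (doubleGreedyProb (f (insert u X) - f X) (f (Y.erase u) - f Y) : ℝ) *
          expectedValue (doubleGreedyLoop f l (insert u X) Y) f +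
        (1 - (doubleGreedyProb (f (insert u X) - f X) (f (Y.erase u) - f Y) : ℝ)) *
          expectedValue (doubleGreedyLoop f l X (Y.erase u)) f := by
      rw [doubleGreedyLoop, expectedValue_bind, Fintype.sum_bool]
      simp [PMF.bernoulli, ENNReal.toReal_sub_of_le
        (ENNReal.coe_le_one_iff.2 (doubleGreedyProb_le_one _ _)) ENNReal.one_ne_top]
    obtain ⟨hp1, hp2⟩ := doubleGreedyProb_spec hab
    have hp0 : (0 : ℝ) ≤ doubleGreedyProb (f (insert u X) - f X) (f (Y.erase u) - f Y) :=
      NNReal.coe_nonneg _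
    have hp0' : (doubleGreedyProb (f (insert u X) - f X) (f (Y.erase u) - f Y) : ℝ) ≤ 1 :=
      NNReal.coe_le_one.2 (doubleGreedyProb_le_one _ _)
    rw [hstep]
    set p : ℝ := (doubleGreedyProb (f (insert u X) - f X) (f (Y.erase u) - f Y) : ℝ)
    have hsum := add_le_add (mul_le_mul_of_nonneg_left h1 hp0)
      (mul_le_mul_of_nonneg_left h2 (sub_nonneg.2 hp0'))
    by_cases huO : u ∈ O
    · have e1 : (O ∪ insert u X) ∩ Y = (O ∪ X) ∩ Y := by
        rw [Finset.union_insert, Finset.insert_eq_of_mem (Finset.mem_union_left _ huO)]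
      -- Wrongly removing `u` costs the corrected optimum at most the gain of adding `u` to `X`.
      have hm := hf.marginal_antitone (A := X) (B := (O ∪ X) ∩ Y.erase u) (u := u)
        (Finset.subset_inter Finset.subset_union_right hXY) (by simp)
      have e2 : insert u ((O ∪ X) ∩ Y.erase u) = (O ∪ X) ∩ Y := by
        rw [Finset.inter_erase, Finset.insert_erase]
        simp [huO, huY]
      rw [e2] at hm
      rw [e1] at hsum
      have := mul_le_mul_of_nonneg_left hm (sub_nonneg.2 hp0')
      nlinarith
    · have e1 : (O ∪ X) ∩ Y.erase u = (O ∪ X) ∩ Y := by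
        rw [Finset.inter_erase, Finset.erase_eq_of_notMem]
        simp [huO, huX]
      -- Wrongly adding `u` costs the corrected optimum at most the gain of removing `u` from `Y`.
      have hm := hf.marginal_antitone (A := (O ∪ X) ∩ Y.erase u) (B := Y.erase u) (u := u)
        Finset.inter_subset_right (Finset.notMem_erase u Y)
      have e2 : insert u ((O ∪ X) ∩ Y) = (O ∪ insert u X) ∩ Y := by
        rw [Finset.union_insert, Finset.insert_inter_of_mem huY]
      rw [Finset.insert_erase huY, e1, e2] at hm
      rw [e1] at hsum
      have := mul_le_mul_of_nonneg_left hm hp0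
      nlinarith

variable {V : Type*} [LinearOrder V]

theorem subset_of_mem_support_doubleGreedy (f : Finset V → ℝ) {A D : Finset V}
    (hD : D ∈ (doubleGreedy f A).support) : D ⊆ A := by
  simpa using subset_of_mem_support_doubleGreedyLoop f hD

theorem le_two_mul_expectedValue_doubleGreedy [Fintype V] {f : Finset V → ℝ}
    (hf0 : ∀ A, 0 ≤ f A) (hf : IsSubmodular f) {A O : Finset V} (hO : O ⊆ A) :
    f O ≤ 2 * expectedValue (doubleGreedy f A) f := by
  have h := le_expectedValue_doubleGreedyLoop hf O (A.sort_nodup (· ≤ ·)) (X := ∅) (Y := A)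
    (by simp) (by simp)
  rw [Finset.union_empty, Finset.inter_eq_left.2 hO] at h
  unfold doubleGreedy
  linarith [hf0 ∅, hf0 A]

end DoubleGreedy

/-! ### Guarantee of the last machine -/

section LastMachine

variable {V : Type*} [Fintype V] [LinearOrder V] {I : Set (Finset V)} {f : Finset V → ℝ}

theorem greedyTwiceDoubleGreedy_support (hI : IsLowerSet I) (h0 : ∅ ∈ I) {A D : Finset V}
    (hD : D ∈ (greedyTwiceDoubleGreedy I f A).support) : D ⊆ A ∧ D ∈ I := by
  unfold greedyTwiceDoubleGreedy at hD
  rw [PMF.mem_support_map_iff] at hD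
  obtain ⟨T, hT, rfl⟩ := hD
  have hTA := subset_of_mem_support_doubleGreedy f hT
  have hmem := bestOf_mem f (greedy I f A) [greedy I f (A \ greedy I f A), T]
  simp only [List.mem_cons, List.not_mem_nil, or_false] at hmem
  rcases hmem with h | h | h <;> rw [h]
  · exact ⟨greedy_subset A, greedy_mem h0 A⟩
  · exact ⟨(greedy_subset _).trans Finset.sdiff_subset, greedy_mem h0 _⟩
  · exact ⟨hTA.trans (greedy_subset A), hI hTA (greedy_mem h0 A)⟩

/-- Split `O` along the first greedy solution `T`. Double greedy handles `O ∩ T` with factor 2,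
giving `2α`; the two greedy solutions handle `O \ T` through (GP), giving the other 2. -/
theorem mul_le_expectedValue_greedyTwiceDoubleGreedy (hI : IsLowerSet I)
    (hf0 : ∀ A : Finset V, 0 ≤ f A) (hf : IsSubmodular f) {α : ℝ} (hα : 0 ≤ α)
    (hGP : GreedyProperty I f α) {A O : Finset V} (hOA : O ⊆ A) (hO : O ∈ I) :
    α * f O ≤ (2 + 2 * α) * expectedValue (greedyTwiceDoubleGreedy I f A) f := by
  set T := greedy I f A with hT
  set T' := greedy I f (A \ T) with hT'
  have hE : expectedValue (greedyTwiceDoubleGreedy I f A) f =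
      expectedValue (doubleGreedy f T) (fun D => f (bestOf f T [T', D])) :=
    expectedValue_map _ _ _
  have hle : ∀ S : Finset V, (∀ D, S ∈ [T, T', D]) →
      f S ≤ expectedValue (greedyTwiceDoubleGreedy I f A) f := by
    intro S hS
    rw [hE, ← expectedValue_const (doubleGreedy f T) (f S)]
    exact expectedValue_mono _ fun D => le_bestOf f (hS D)
  have h1 := hle T (by simp)
  have h2 := hle T' (by simp)
  have h3 : expectedValue (doubleGreedy f T) f ≤
      expectedValue (greedyTwiceDoubleGreedy I f A) f := by
    rw [hE]
    exact expectedValue_mono _ fun D => le_bestOf f (by simp)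
  have h4 := le_two_mul_expectedValue_doubleGreedy hf0 hf (Finset.inter_subset_right : O ∩ T ⊆ T)
  have h5 : f O ≤ f (O ∩ T) + f (O \ T) := by
    have := hf (O ∩ T) (O \ T)
    rw [Finset.union_comm, Finset.sdiff_union_inter] at this
    linarith [hf0 (O ∩ T ∩ (O \ T))]
  have hOT : O \ T ∈ I := hI Finset.sdiff_subset hO
  have h6 := hGP A (O \ T) (Finset.sdiff_subset.trans hOA) hOT
  -- `O \ T` survives into the second ground set, so both passes compete with the same set.
  have h7 := hGP (A \ T) (O \ T) (Finset.sdiff_subset_sdiff hOA le_rfl) hOT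
  have h8 := hf.le_add_of_union_of_disjoint hf0
    (disjoint_greedy_greedy_sdiff (I := I) (f := f) A) (O \ T)
  nlinarith

end LastMachine

/-! ### Averaging over the random assignment -/

section Assignment

theorem machinePart_update {V : Type*} [DecidableEq V] {m : ℕ} {A : Finset V} {e : V} (he : e ∈ A) (σ : V → Fin m)
    (j : Fin m) :
    machinePart A (Function.update σ e j) j = insert e (machinePart A σ j) := by
  ext x
  by_cases hx : x = e
  · simp [machinePart, hx, he]
  · simp [machinePart, hx]

variable {V : Type*} [Fintype V] [DecidableEq V]

/-- Resampling one coordinate of a uniformly random function does not change its law. -/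
theorem sum_sum_update {β : Type*} [Fintype β] (φ : (V → β) → ℝ) (e : V) :
    ∑ σ, ∑ j, φ (Function.update σ e j) = Fintype.card β * ∑ σ, φ σ := by
  classical
  -- Exchanging the fresh value with the old coordinate is a measure-preserving involution on pairs.
  have hinv : Function.Involutive
      fun x : (V → β) × β => (Function.update x.1 e x.2, x.1 e) := by
    rintro ⟨σ, j⟩
    simp
  have h := Equiv.sum_comp hinv.toPerm fun x : (V → β) × β => φ x.1
  rw [Fintype.sum_prod_type, Fintype.sum_prod_type] at h
  simpa [← Finset.mul_sum] using h

/-- An element is selected on its own machine as often as it would be selected on average by a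
machine to which it is added. -/
theorem sum_mem_biUnion_machinePart {m : ℕ} (F : Finset V → Finset V) (hF : ∀ A, F A ⊆ A)
    {A : Finset V} {e : V} (he : e ∈ A) :
    (∑ σ : V → Fin m, ∑ i, if e ∈ F (insert e (machinePart A σ i)) then (1 : ℝ) else 0) =
      m * ∑ σ : V → Fin m,
        if e ∈ Finset.univ.biUnion (fun i => F (machinePart A σ i)) then (1 : ℝ) else 0 := by
  -- As `F` selects from its input only, `e` can be selected by its own machine alone.
  have hiff : ∀ σ : V → Fin m, e ∈ Finset.univ.biUnion (fun i => F (machinePart A σ i)) ↔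
      e ∈ F (machinePart A σ (σ e)) := by
    intro σ
    simp only [Finset.mem_biUnion, Finset.mem_univ, true_and]
    refine ⟨fun ⟨i, hi⟩ => ?_, fun h => ⟨_, h⟩⟩
    have : σ e = i := (Finset.mem_filter.1 (hF _ hi)).2
    rwa [this]
  have h := sum_sum_update (β := Fin m)
    (fun σ => if e ∈ Finset.univ.biUnion (fun i => F (machinePart A σ i)) then (1 : ℝ) else 0) e
  simp only [hiff, Function.update_self, machinePart_update he, Fintype.card_fin] at h
  simpa only [hiff] using h

/-- The elements of `O` that are lost on one machine and the elements of `O` that are selected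
together account for the value of `O`. -/
theorem card_mul_le_sum_machinePart {f : Finset V → ℝ} (hf0 : ∀ A, 0 ≤ f A)
    (hf : IsSubmodular f) {m : ℕ} (F : Finset V → Finset V) (hF : ∀ A, F A ⊆ A)
    {A O : Finset V} (hOA : O ⊆ A) :
    m * (Fintype.card (V → Fin m) * f O) ≤ ∑ σ : V → Fin m,
      ((∑ i, f (O.filter fun e => e ∉ F (insert e (machinePart A σ i)))) +
        m * f (O.filter fun e => e ∈ Finset.univ.biUnion fun i => F (machinePart A σ i))) := by
  obtain ⟨g, hgO, hg⟩ := hf.exists_modular_minorant O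
  have hlow : ∀ σ : V → Fin m,
      ((∑ i : Fin m, (f ∅ + ∑ e ∈ O,
          (1 - if e ∈ F (insert e (machinePart A σ i)) then (1 : ℝ) else 0) * g e)) +
        m * (f ∅ + ∑ e ∈ O, (if e ∈ Finset.univ.biUnion (fun i => F (machinePart A σ i))
          then (1 : ℝ) else 0) * g e)) ≤
      (∑ i, f (O.filter fun e => e ∉ F (insert e (machinePart A σ i)))) +
        m * f (O.filter fun e => e ∈ Finset.univ.biUnion fun i => F (machinePart A σ i)) := by
    intro σ
    refine add_le_add (Finset.sum_le_sum fun i _ => ?_)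
      (mul_le_mul_of_nonneg_left ?_ (Nat.cast_nonneg m))
    · refine le_trans (le_of_eq ?_) (hg _ (Finset.filter_subset _ _))
      rw [Finset.sum_filter]
      congr 1
      refine Finset.sum_congr rfl fun e _ => ?_
      split_ifs <;> simp
    · refine le_trans (le_of_eq ?_) (hg _ (Finset.filter_subset _ _))
      rw [Finset.sum_filter]
      congr 1
      refine Finset.sum_congr rfl fun e _ => ?_
      split_ifs <;> simp
  refine le_trans ?_ (Finset.sum_le_sum fun σ _ => hlow σ)
  have hcount : ∑ σ : V → Fin m, (∑ i : Fin m, ∑ e ∈ O,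
        (1 - if e ∈ F (insert e (machinePart A σ i)) then (1 : ℝ) else 0) * g e) =
      m * Fintype.card (V → Fin m) * (∑ e ∈ O, g e) - m * ∑ σ : V → Fin m, ∑ e ∈ O,
        (if e ∈ Finset.univ.biUnion (fun i => F (machinePart A σ i)) then (1 : ℝ) else 0) *
          g e := by
    have hcomm : ∀ σ : V → Fin m, (∑ i : Fin m, ∑ e ∈ O,
        (1 - if e ∈ F (insert e (machinePart A σ i)) then (1 : ℝ) else 0) * g e) =
        ∑ e ∈ O, ∑ i : Fin m,
          (1 - if e ∈ F (insert e (machinePart A σ i)) then (1 : ℝ) else 0) * g e :=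
      fun σ => Finset.sum_comm
    simp only [hcomm]
    rw [Finset.sum_comm, Finset.sum_comm (s := Finset.univ) (t := O), Finset.mul_sum,
      Finset.mul_sum, ← Finset.sum_sub_distrib]
    refine Finset.sum_congr rfl fun e he => ?_
    simp only [← Finset.sum_mul, Finset.sum_sub_distrib]
    -- For each element, the number of rejections is the total count minus exactly what the selected
    -- term contributes.
    rw [sum_mem_biUnion_machinePart F hF (hOA he)]
    simp only [Finset.sum_const, Finset.card_univ, Fintype.card_fin, nsmul_eq_mul, mul_one]
    ring
  simp only [Finset.sum_add_distrib, mul_add, hcount]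
  simp only [Finset.sum_const, Finset.card_univ, Fintype.card_fin, nsmul_eq_mul,
    ← Finset.mul_sum]
  -- Both minorants carry the constant `f ∅`, but `f O` uses it once; the surplus is nonnegative.
  have hnn : 0 ≤ (m : ℝ) * Fintype.card (V → Fin m) * f ∅ :=
    mul_nonneg (by positivity) (hf0 ∅)
  rw [← hgO]
  linarith

end Assignment

/-! ### The distributed algorithm -/

section Distributed

variable {V : Type*} [Fintype V] [LinearOrder V] {I : Set (Finset V)} {f : Finset V → ℝ}

theorem firstSol_union_secondSol {m : ℕ} (A : Finset V) (σ : V → Fin m) (i : Fin m) :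
    firstSol I f A σ i ∪ secondSol I f A σ i = twoPassGreedy I f (machinePart A σ i) := rfl

theorem nmRandGreeDi_support (h0 : ∅ ∈ I) {m : ℕ} [NeZero m]
    {alg : Finset V → PMF (Finset V)}
    (halg : ∀ B, ∀ D ∈ (alg B).support, D ⊆ B ∧ D ∈ I) {A D : Finset V}
    (hD : D ∈ (nmRandGreeDi I f m alg A).support) : D ⊆ A ∧ D ∈ I := by
  unfold nmRandGreeDi at hD
  rw [PMF.mem_support_bind_iff] at hD
  obtain ⟨σ, -, hD⟩ := hD
  rw [PMF.mem_support_map_iff] at hD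
  obtain ⟨T, hT, rfl⟩ := hD
  have hpart : ∀ i, machinePart A σ i ⊆ A := fun i => Finset.filter_subset _ _
  rcases List.mem_cons.1 (bestOf_mem f T _) with h | h
  · rw [h]
    obtain ⟨hTU, hTI⟩ := halg _ T hT
    refine ⟨hTU.trans (Finset.biUnion_subset.2 fun i _ => ?_), hTI⟩
    rw [firstSol_union_secondSol]
    exact (twoPassGreedy_subset _).trans (hpart i)
  · obtain ⟨i, -, hi⟩ := List.mem_flatMap.1 h
    simp only [List.mem_cons, List.not_mem_nil, or_false] at hi
    rcases hi with hi | hi <;> rw [hi]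
    · exact ⟨(greedy_subset _).trans (hpart i), greedy_mem h0 _⟩
    · exact ⟨(greedy_subset _).trans (Finset.sdiff_subset.trans (hpart i)), greedy_mem h0 _⟩

end Distributed

theorem mainTheorem4 {V : Type*} [Fintype V] [LinearOrder V]
    (I : Set (Finset V)) (hI : IsLowerSet I) (hne : I.Nonempty)
    (f : Finset V → ℝ) (hf0 : ∀ A : Finset V, 0 ≤ f A) (hf : IsSubmodular f)
    (α : ℝ) (hα : 0 ≤ α) (hGP : GreedyProperty I f α)
    (m : ℕ) [NeZero m] :
    IsApproxInExpectation I f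
      (nmRandGreeDi I f m (greedyTwiceDoubleGreedy I f)) (α / (4 + 2 * α)) := by
  have h0 : ∅ ∈ I := hne.elim fun S hS => hI (Finset.empty_subset S) hS
  refine fun A => ⟨fun D hD => nmRandGreeDi_support h0
    (fun B D hD => greedyTwiceDoubleGreedy_support hI h0 hD) hD, fun O hOA hO => ?_⟩
  set U : (V → Fin m) → Finset V := fun σ =>
    Finset.univ.biUnion fun i => twoPassGreedy I f (machinePart A σ i)
  -- `E σ` is the expected output value conditional on the assignment; only the double greedy coins
  -- are averaged.
  set E : (V → Fin m) → ℝ := fun σ =>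
    expectedValue (greedyTwiceDoubleGreedy I f (U σ)) fun T => f (bestOf f T
      ((List.finRange m).flatMap fun i => [firstSol I f A σ i, secondSol I f A σ i])) with hE
  have hEV : expectedValue (nmRandGreeDi I f m (greedyTwiceDoubleGreedy I f) A) f =
      (∑ σ, E σ) / Fintype.card (V → Fin m) := by
    unfold nmRandGreeDi
    rw [expectedValue_bind, Finset.sum_div]
    refine Finset.sum_congr rfl fun σ _ => ?_
    rw [expectedValue_map, PMF.uniformOfFintype_apply, ENNReal.toReal_inv,
      ENNReal.toReal_natCast, div_eq_inv_mul]
    rfl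
  have hm : (0 : ℝ) < m := Nat.cast_pos.2 (NeZero.pos m)
  have hcard : (0 : ℝ) < Fintype.card (V → Fin m) := Nat.cast_pos.2 Fintype.card_pos
  have hsol : ∀ σ i, f (firstSol I f A σ i) ≤ E σ ∧ f (secondSol I f A σ i) ≤ E σ := by
    have aux : ∀ σ S, S ∈ (List.finRange m).flatMap
        (fun i => [firstSol I f A σ i, secondSol I f A σ i]) → f S ≤ E σ := by
      intro σ S hS
      rw [hE, ← expectedValue_const (greedyTwiceDoubleGreedy I f (U σ)) (f S)]
      exact expectedValue_mono _ fun T => le_bestOf f (List.mem_cons_of_mem _ hS)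
    exact fun σ i => ⟨aux σ _ (List.mem_flatMap.2 ⟨i, List.mem_finRange i, by simp⟩),
      aux σ _ (List.mem_flatMap.2 ⟨i, List.mem_finRange i, by simp⟩)⟩
  have hlast : ∀ σ, α * f (O.filter fun e => e ∈ U σ) ≤ (2 + 2 * α) * E σ := by
    intro σ
    refine (mul_le_expectedValue_greedyTwiceDoubleGreedy hI hf0 hf hα hGP
      (A := U σ) (fun e he => (Finset.mem_filter.1 he).2)
      (hI (Finset.filter_subset _ _) hO)).trans (mul_le_mul_of_nonneg_left ?_ (by positivity))
    exact expectedValue_mono _ fun T => le_bestOf f List.mem_cons_self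
  have hlost : ∀ σ i, α * f (O.filter fun e =>
      e ∉ twoPassGreedy I f (insert e (machinePart A σ i))) ≤ 2 * E σ := by
    intro σ i
    have h := mul_le_greedy_add_greedy hf0 hf hα hGP (A := machinePart A σ i)
      (hI (Finset.filter_subset (fun e =>
        e ∉ twoPassGreedy I f (insert e (machinePart A σ i))) O) hO)
      (fun e he => (Finset.mem_filter.1 he).2)
    have h' := hsol σ i
    simp only [firstSol, secondSol] at h'
    linarith
  have hsum := card_mul_le_sum_machinePart hf0 hf (m := m) (twoPassGreedy I f)
    twoPassGreedy_subset hOA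
  -- Each of the `m` machines contributes 2 through its lost set, and the weight `m` on the selected
  -- set contributes `2 + 2α` each time.
  have hbound : ∀ σ : V → Fin m, α * ((∑ i, f (O.filter fun e =>
        e ∉ twoPassGreedy I f (insert e (machinePart A σ i)))) +
      m * f (O.filter fun e => e ∈ U σ)) ≤ m * ((4 + 2 * α) * E σ) := by
    intro σ
    have h1 : α * (∑ i, f (O.filter fun e =>
        e ∉ twoPassGreedy I f (insert e (machinePart A σ i)))) ≤ m * (2 * E σ) := by
      rw [Finset.mul_sum]
      refine (Finset.sum_le_sum fun i _ => hlost σ i).trans (le_of_eq ?_)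
      simp
    have h2 := mul_le_mul_of_nonneg_left (hlast σ) hm.le
    linarith
  have htotal := (mul_le_mul_of_nonneg_left hsum hα).trans
    ((Finset.mul_sum _ _ _).trans_le (Finset.sum_le_sum fun σ _ => hbound σ))
  rw [← Finset.mul_sum, ← Finset.mul_sum] at htotal
  rw [hEV, div_mul_eq_mul_div, div_le_div_iff₀ (by positivity) hcard]
  refine le_of_mul_le_mul_left ?_ hm
  linarith
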